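/- Let $\mathcal{E}$ be a finite-dimensional real inner product space, let $\mathcal{M}$ be a finite-dimensional smooth Riemannian manifold without boundary, and let $\mathcal{M}\subset\mathcal{E}$ be a smooth embedding (the Riemannian metric $\langle\cdot,\cdot\rangle_R$ of $\mathcal{M}$ need not be induced by $\mathcal{E}$). Identify $T_x\mathcal{M}$ with a subspace of $\mathcal{E}$ and vector fields on $\mathcal{M}$ with $\mathcal{E}$-valued functions; $D_\xi$ denotes the directional derivative of a vector- or operator-valued function on $\mathcal{M}$ along a tangent vector $\xi$. Let $\mathsf{g}$ be a metric operator: a smooth function from $\mathcal{M}$ to the self-adjoint positive definite operators on $\mathcal{E}$ with $\langle\xi,\eta\rangle_{R}=\langle\xi,\mathsf{g}_x\eta\rangle_{\mathcal{E}}$ for all $x\in\mathcal{M}$, $\xi,\eta\in T_x\mathcal{M}$. Let $\Pi_x$ be the projection of $\mathcal{E}$ onto $T_x\mathcal{M}$ that is orthogonal for $\langle\cdot,\mathsf{g}_x\cdot\rangle_{\mathcal{E}}$, let $\nabla$ be the Levi-Civita connection of $\mathcal{M}$, and let $\Gamma$ be any Christoffel function: a smooth function from $\mathcal{M}$ to the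 $\mathcal{E}$-valued bilinear maps on $\mathcal{E}$ with $\nabla_XY=D_XY+\Gamma(X,Y)$ for all smooth vector fields $X,Y$ on $\mathcal{M}$. Let $R$ be the Riemannian curvature tensor with the sign convention $R_{X,Y}Z=\nabla_{[X,Y]}Z-\nabla_X\nabla_YZ+\nabla_Y\nabla_XZ$. Then for all $x\in\mathcal{M}$ and $\xi,\eta,\phi\in T_x\mathcal{M}$, with all expressions evaluated at $x$ (and the derivatives of $\Gamma$ taken as a function with values in the bilinear maps): (1) $R_{\xi,\eta}\phi=-(D_\xi\Gamma)(\eta,\phi)+(D_\eta\Gamma)(\xi,\phi)-\Gamma(\xi,\Gamma(\eta,\phi))+\Gamma(\eta,\Gamma(\xi,\phi))$. (2) $R_{\xi,\eta}\phi=-(D_\xi\Gamma)(\phi,\eta)+(D_\eta\Gamma)(\phi,\xi)-\Gamma(\Gamma(\phi,\eta),\xi)+\Gamma(\Gamma(\phi,\xi),\eta)$; moreover, if $\Gamma_x(\zeta,\omega)=\Gamma_x(\omega,\zeta)$ for all $\zeta\in T_x\mathcal{M}$, $\omega\in\mathcal{E}$, then also $R_{\xi,\eta}\phi=-(D_\xi\Gamma)(\eta,\phi)+(D_\eta\Gamma)(\xi,\phi)-\Gamma(\Gamma(\phi,\eta),\xi)+\Gamma(\Gamma(\phi,\xi),\eta)$.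 (3) There are smooth functions $\mathring{\Gamma}$ from $\mathcal{M}$ to the $\mathcal{E}$-valued bilinear maps on $\mathcal{E}$ with $\mathring{\Gamma}(\zeta,\omega)=(D_\zeta\Pi)\omega+\Gamma(\zeta,\omega)$ for all tangent vectors $\zeta$ and all $\omega\in\mathcal{E}$, and for each of them $R_{\xi,\eta}\phi=-(D_\xi\mathring{\Gamma})(\eta,\phi)+(D_\eta\mathring{\Gamma})(\xi,\phi)-\Gamma(\xi,\Gamma(\eta,\phi))+\Gamma(\eta,\Gamma(\xi,\phi))$. -/

import Mathlib

open Bundle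
open scoped Manifold ContDiff InnerProductSpace

noncomputable section

namespace EmbeddedCurvature

section

variable {V : Type*} [NormedAddCommGroup V] [NormedSpace ℝ V]
  {M : Type*} [TopologicalSpace M] [ChartedSpace V M]
  {E : Type*} [NormedAddCommGroup E] [InnerProductSpace ℝ E] [FiniteDimensional ℝ E]

/-- The directional derivative `D_ξ F` at `x` of a function `F` on the manifold `M` with values
in a normed space, in the direction of a tangent vector `ξ` at `x`. -/
abbrev dirDeriv {F : Type*} [NormedAddCommGroup F] [NormedSpace ℝ F]
    (f : M → F) (x : M) (ξ : TangentSpace 𝓘(ℝ, V) x) : F :=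
  mvfderiv 𝓘(ℝ, V) f x ξ

/-- The tangent space of `M` at `x`, identified with a subspace of the ambient space `E` through
the differential of the inclusion `ι : M → E`. -/
def ambientTangentSpace (ι : M → E) (x : M) : Submodule ℝ E :=
  LinearMap.range (mvfderiv 𝓘(ℝ, V) ι x).toLinearMap

/-- A vector field on `M`, identified with an `E`-valued function on `M`. -/
def ambientField (ι : M → E) (Y : Π x : M, TangentSpace 𝓘(ℝ, V) x) : M → E :=
  fun x => dirDeriv ι x (Y x)

/-- `Y` is a smooth vector field on `M`, that is, a smooth section of the tangent bundle. -/
def IsSmoothField [IsManifold 𝓘(ℝ, V) ∞ M] (Y : Π x : M, TangentSpace 𝓘(ℝ, V) x) : Prop :=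
  ContMDiff 𝓘(ℝ, V) (𝓘(ℝ, V).prod 𝓘(ℝ, V)) ∞
    (fun x => (⟨x, Y x⟩ : TotalSpace V (fun x : M => TangentSpace 𝓘(ℝ, V) x)))

/-- `g` is a metric operator: a smooth function from `M` to the self-adjoint positive definite
operators on `E`, such that `⟪ξ, g η⟫` is the Riemannian metric of `M` on tangent vectors. -/
structure IsMetricOperator [RiemannianBundle (fun x : M => TangentSpace 𝓘(ℝ, V) x)]
    (ι : M → E) (g : M → E →L[ℝ] E) : Prop where
  smooth : ContMDiff 𝓘(ℝ, V) 𝓘(ℝ, E →L[ℝ] E) ∞ g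
  selfAdjoint : ∀ x w₁ w₂, ⟪g x w₁, w₂⟫_ℝ = ⟪w₁, g x w₂⟫_ℝ
  pos : ∀ x w, w ≠ 0 → 0 < ⟪w, g x w⟫_ℝ
  induces : ∀ (x : M) (ξ η : TangentSpace 𝓘(ℝ, V) x),
    ⟪ξ, η⟫_ℝ = ⟪dirDeriv ι x ξ, g x (dirDeriv ι x η)⟫_ℝ

/-- A subspace `T` and its orthogonal complement for the inner product `⟪·, g ·⟫`. -/
theorem isCompl_of_pos (T : Submodule ℝ E) (A : E →L[ℝ] E)
    (hpos : ∀ w, w ≠ 0 → 0 < ⟪w, A w⟫_ℝ) : IsCompl T (T.map A.toLinearMap)ᗮ := by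
  have hinj : Function.Injective A.toLinearMap := by
    refine (injective_iff_map_eq_zero _).2 fun w hw => ?_
    by_contra h
    have h1 := hpos w h
    have h2 : A w = 0 := hw
    simp [h2] at h1
  have hdisj : Disjoint T (T.map A.toLinearMap)ᗮ := by
    rw [Submodule.disjoint_def]
    intro w hT hO
    by_contra h
    have h1 := hpos w h
    have h2 := (Submodule.mem_orthogonal _ _).1 hO (A w) ⟨w, hT, rfl⟩
    rw [real_inner_comm] at h2
    exact absurd h2 h1.ne'
  refine Submodule.isCompl_iff_disjoint _ _ ?_ |>.2 hdisj
  have h1 := Submodule.finrank_add_finrank_orthogonal (T.map A.toLinearMap)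
  have h2 : Module.finrank ℝ (T.map A.toLinearMap) = Module.finrank ℝ T :=
    (Submodule.equivMapOfInjective A.toLinearMap hinj T).finrank_eq.symm
  omega

open Classical in
/-- The projection `Π` of `g` at `x`: the projection from `E` onto the tangent space of `M` at `x`
that is orthogonal for the inner product `⟪w₁, g x w₂⟫`, that is, along the subspace
`{w | ⟪g x τ, w⟫ = 0 for all tangent τ}`. That the two subspaces are complementary is automatic
if `g x` is positive definite. -/
def metricProjection (ι : M → E) (g : M → E →L[ℝ] E) (x : M) : E →L[ℝ] E :=
  if h : IsCompl (ambientTangentSpace (V := V) ι x)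
      ((ambientTangentSpace (V := V) ι x).map (g x).toLinearMap)ᗮ then
    LinearMap.toContinuousLinearMap (Submodule.projection _ _ h)
  else 0

theorem metricProjection_mem (ι : M → E) (g : M → E →L[ℝ] E) (x : M) (w : E) :
    metricProjection (V := V) ι g x w ∈ ambientTangentSpace (V := V) ι x := by
  unfold metricProjection
  split_ifs with h
  · exact Submodule.projection_apply_mem h w
  · exact Submodule.zero_mem _

theorem metricProjection_orthogonal (ι : M → E) (g : M → E →L[ℝ] E) (x : M)
    (hpos : ∀ w, w ≠ 0 → 0 < ⟪w, g x w⟫_ℝ) (w τ : E)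
    (hτ : τ ∈ ambientTangentSpace (V := V) ι x) :
    ⟪w - metricProjection (V := V) ι g x w, g x τ⟫_ℝ = 0 := by
  have h := isCompl_of_pos (ambientTangentSpace (V := V) ι x) (g x) hpos
  unfold metricProjection
  rw [dif_pos h, real_inner_comm]
  have h1 : w - Submodule.projection _ _ h w ∈
      ((ambientTangentSpace (V := V) ι x).map (g x).toLinearMap)ᗮ := by
    rw [← Submodule.projection_eq_self_sub_projection]
    exact Submodule.projection_apply_mem h.symm w
  exact (Submodule.mem_orthogonal _ _).1 h1 _ ⟨τ, hτ, rfl⟩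

variable [FiniteDimensional ℝ V] [IsManifold 𝓘(ℝ, V) ∞ M]

/-- A covariant derivative on the tangent bundle of `M`; `cov Y x ξ` is `∇_ξ Y` at `x`. -/
abbrev Connection (V M : Type*) [NormedAddCommGroup V] [NormedSpace ℝ V]
    [TopologicalSpace M] [ChartedSpace V M] [IsManifold 𝓘(ℝ, V) ∞ M] :=
  CovariantDerivative 𝓘(ℝ, V) V (fun x : M => TangentSpace 𝓘(ℝ, V) x)

/-- The Levi-Civita connection: torsion-free and compatible with the Riemannian metric. -/
structure IsLeviCivita [RiemannianBundle (fun x : M => TangentSpace 𝓘(ℝ, V) x)]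
    (cov : Connection V M) : Prop where
  torsionFree : cov.torsion = 0
  metric : ∀ X Y Z : Π x : M, TangentSpace 𝓘(ℝ, V) x,
    IsSmoothField X → IsSmoothField Y → IsSmoothField Z → ∀ x : M,
      dirDeriv (fun y => ⟪Y y, Z y⟫_ℝ) x (X x) = ⟪cov Y x (X x), Z x⟫_ℝ + ⟪Y x, cov Z x (X x)⟫_ℝ

/-- `Γ` is a Christoffel function for the (Levi-Civita) connection `∇`: a smooth function from `M`
to the `E`-valued bilinear maps on `E` with `∇_X Y = D_X Y + Γ(X, Y)` for all smooth vector fields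
`X`, `Y` on `M`. No other condition is imposed on `Γ(w₁, w₂)` for `w₁`, `w₂` not tangent to `M`. -/
structure IsChristoffelFunction (ι : M → E) (cov : Connection V M)
    (Γ : M → E →L[ℝ] E →L[ℝ] E) : Prop where
  smooth : ContMDiff 𝓘(ℝ, V) 𝓘(ℝ, E →L[ℝ] E →L[ℝ] E) ∞ Γ
  eq : ∀ X Y : Π x : M, TangentSpace 𝓘(ℝ, V) x, IsSmoothField X → IsSmoothField Y →
    ∀ x : M, dirDeriv ι x (cov Y x (X x)) =
      dirDeriv (ambientField ι Y) x (X x) + Γ x (ambientField ι X x) (ambientField ι Y x)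

/-- `Γ'` is a smooth function from `M` to the `E`-valued bilinear maps on `E` that satisfies
`Γ'(ξ, w) = (D_ξ Π) w + Γ(ξ, w)` for all tangent vectors `ξ` and all `w` in `E`. -/
structure IsRingChristoffel (ι : M → E) (g : M → E →L[ℝ] E)
    (Γ Γ' : M → E →L[ℝ] E →L[ℝ] E) : Prop where
  smooth : ContMDiff 𝓘(ℝ, V) 𝓘(ℝ, E →L[ℝ] E →L[ℝ] E) ∞ Γ'
  eq : ∀ (x : M) (ξ : TangentSpace 𝓘(ℝ, V) x) (w : E),
    Γ' x (dirDeriv ι x ξ) w =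
      dirDeriv (metricProjection (V := V) ι g) x ξ w + Γ x (dirDeriv ι x ξ) w

/-- The curvature of `∇` on vector fields,
`R_{X,Y} Z = ∇_{[X,Y]} Z - ∇_X ∇_Y Z + ∇_Y ∇_X Z`. -/
def fieldCurvature (cov : Connection V M) (X Y Z : Π x : M, TangentSpace 𝓘(ℝ, V) x) (x : M) :
    TangentSpace 𝓘(ℝ, V) x :=
  cov Z x (VectorField.mlieBracket 𝓘(ℝ, V) X Y x)
    - cov (fun y => cov Z y (Y y)) x (X x)
    + cov (fun y => cov Z y (X y)) x (Y x)

/-- `ρ` is the value `R_{ξ,η} φ` of the curvature tensor of `∇` at `x`: the three tangent vectors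
extend to smooth vector fields `X`, `Y`, `Z` on `M`, and `R_{X,Y} Z` takes the value `ρ` at `x`
for every choice of extensions. -/
structure IsCurvature (cov : Connection V M) (x : M) (ξ η φ ρ : TangentSpace 𝓘(ℝ, V) x) :
    Prop where
  exists_extension : ∃ X Y Z : Π x : M, TangentSpace 𝓘(ℝ, V) x,
    IsSmoothField X ∧ IsSmoothField Y ∧ IsSmoothField Z ∧ X x = ξ ∧ Y x = η ∧ Z x = φ
  eq : ∀ X Y Z : Π x : M, TangentSpace 𝓘(ℝ, V) x,
    IsSmoothField X → IsSmoothField Y → IsSmoothField Z → X x = ξ → Y x = η → Z x = φ →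
    fieldCurvature cov X Y Z x = ρ

end

end EmbeddedCurvature

end

open EmbeddedCurvature

/-! Through `dι` everything becomes a statement about `E`-valued functions. The facts used
throughout are `D_X D_Y f - D_Y D_X f = D_[X,Y] f` for vector-valued `f` (`dirDeriv_mlieBracket`)
and its case `f = ι`, namely `D_X Y - D_Y X = [X,Y]`.

For (1), expand `∇_X ∇_Y Z` with `∇ = D + Γ` and antisymmetrize in `X`, `Y`. The derivatives of the
fields combine into `D_[X,Y] Z + Γ([X,Y], Z) = ∇_[X,Y] Z`, which cancels; what remains depends only
on values at `x`. Since `dι` is injective, the curvature is thereby independent of the extensions.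
Iterating the formula requires `∇_Y Z` to be a smooth section (`IsMetricOperator.isSmoothField`).

For (2), zero torsion makes `Γ` symmetric on tangent vectors. Differentiating `Γ(Y,Z) = Γ(Z,Y)`
along `ξ` measures the failure of `D_ξ Γ` to be symmetric
(`IsChristoffelFunction.dirDeriv_sub_dirDeriv_flip`); substitution in (1) gives (2).

For (3), `S = Γ' - Γ` satisfies `S(ζ) = D_ζ Π` on tangent vectors, so `(D_ξ S)η = (D_η S)ξ`
(`dirDeriv_symm_of_eq_dirDeriv`), and `Γ'` may replace `Γ` in the derivative terms. Existence comes
from `Γ'(a, b) = (D_{Πa} Π) b + Γ(a, b)`, with `Π` smooth because locally `Π = A (A* g A)⁻¹ A* g`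
for `A` the derivative of `ι` in a chart. -/

namespace EmbeddedCurvature

open Set Filter
open scoped Topology

/-! ### Smooth vector fields, derivatives in charts and the Lie bracket -/

section Manifold

variable {V : Type*} [NormedAddCommGroup V] [NormedSpace ℝ V] [FiniteDimensional ℝ V]
  {M : Type*} [TopologicalSpace M] [ChartedSpace V M] [IsManifold 𝓘(ℝ, V) ∞ M]
  {F : Type*} [NormedAddCommGroup F] [NormedSpace ℝ F]

omit [FiniteDimensional ℝ V] [IsManifold 𝓘(ℝ, V) ∞ M] in
theorem mdifferentiableAt_of_contMDiff {f : M → F} (hf : ContMDiff 𝓘(ℝ, V) 𝓘(ℝ, F) ∞ f) (x : M) :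
    MDifferentiableAt 𝓘(ℝ, V) 𝓘(ℝ, F) f x :=
  hf.mdifferentiableAt (by simp)

omit [FiniteDimensional ℝ V] in
/-- The derivative of a smooth function along a smooth vector field is smooth. -/
theorem IsSmoothField.contMDiff_dirDeriv {Y : Π x : M, TangentSpace 𝓘(ℝ, V) x}
    (hY : IsSmoothField Y) {f : M → F} (hf : ContMDiff 𝓘(ℝ, V) 𝓘(ℝ, F) ∞ f) :
    ContMDiff 𝓘(ℝ, V) 𝓘(ℝ, F) ∞ (fun x => dirDeriv f x (Y x)) := by
  have h1 : ContMDiff 𝓘(ℝ, V).tangent 𝓘(ℝ, F).tangent ∞ (tangentMap 𝓘(ℝ, V) 𝓘(ℝ, F) f) :=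
    hf.contMDiff_tangentMap (by simp)
  have h2 := (contMDiff_snd_tangentBundle_modelSpace F 𝓘(ℝ, F) (n := ∞)).comp (h1.comp hY)
  exact h2

/-- Partition of unity: the fibrewise constraint is `{ξ}` at `x` and the whole tangent space
elsewhere, hence convex. Local solutions are a section constant in a trivialization near `x`, and
the zero section off `x`. -/
theorem exists_isSmoothField_eq [T2Space M] [SigmaCompactSpace M] (x : M)
    (ξ : TangentSpace 𝓘(ℝ, V) x) :
    ∃ X : Π x : M, TangentSpace 𝓘(ℝ, V) x, IsSmoothField X ∧ X x = ξ := by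
  classical
  obtain ⟨s, hs⟩ := exists_contMDiffSection_forall_mem_convex_of_local 𝓘(ℝ, V) (n := (⊤ : ℕ∞))
    (fun x : M => TangentSpace 𝓘(ℝ, V) x) (fun y => {v | ∀ h : y = x, v = h ▸ ξ})
    (fun y => by
      by_cases h : y = x
      · subst h
        simp
      · simpa [h] using! convex_univ)
    (fun x₀ => by
      by_cases hx : x₀ = x
      · subst hx
        set e := trivializationAt V (TangentSpace 𝓘(ℝ, V) : M → Type _) x₀ with he
        have hx₀ : x₀ ∈ e.baseSet := FiberBundle.mem_baseSet_trivializationAt' x₀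
        refine ⟨e.baseSet, e.open_baseSet.mem_nhds hx₀, FiberBundle.extend V ξ, ?_, ?_⟩
        · rw [e.contMDiffOn_section_baseSet_iff]
          refine (contMDiffOn_const (c := (e ⟨x₀, ξ⟩).2)).congr fun y hy => ?_
          simp only [FiberBundle.extend]
          have h : (e ⟨y, e.symm y (e ⟨x₀, ξ⟩).2⟩).2 = (e ⟨x₀, ξ⟩).2 := by
            rw [e.apply_mk_symm hy]
          exact h
        · intro y _ h
          subst h
          simp
      · refine ⟨{x}ᶜ, isOpen_compl_singleton.mem_nhds hx, 0, ?_, fun y hy h => absurd h hy⟩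
        exact (contMDiff_zeroSection ℝ (fun x : M => TangentSpace 𝓘(ℝ, V) x)).contMDiffOn)
  exact ⟨s, s.contMDiff, hs x rfl⟩

omit [FiniteDimensional ℝ V] in
theorem mvfderiv_eq_fderiv_extChartAt (x : M) {h : M → F} {y : M}
    (hy : y ∈ (extChartAt 𝓘(ℝ, V) x).source)
    (hh : MDifferentiableAt 𝓘(ℝ, V) 𝓘(ℝ, F) h y) (ξ : TangentSpace 𝓘(ℝ, V) y) :
    mvfderiv 𝓘(ℝ, V) h y ξ = fderiv ℝ (h ∘ (extChartAt 𝓘(ℝ, V) x).symm) (extChartAt 𝓘(ℝ, V) x y)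
      (mfderiv 𝓘(ℝ, V) 𝓘(ℝ, V) (extChartAt 𝓘(ℝ, V) x) y ξ) := by
  have hty := (extChartAt 𝓘(ℝ, V) x).map_source hy
  have h3 : (extChartAt 𝓘(ℝ, V) x).symm (extChartAt 𝓘(ℝ, V) x y) = y :=
    (extChartAt 𝓘(ℝ, V) x).left_inv hy
  have h1 : MDifferentiableAt 𝓘(ℝ, V) 𝓘(ℝ, F) (h ∘ (extChartAt 𝓘(ℝ, V) x).symm)
      (extChartAt 𝓘(ℝ, V) x y) := by
    refine MDifferentiableAt.comp _ (by rwa [h3]) ?_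
    exact (((contMDiffOn_extChartAt_symm (n := 1) x).contMDiffAt
      ((isOpen_extChartAt_target x).mem_nhds hty)).mdifferentiableAt one_ne_zero)
  have h2 : MDifferentiableAt 𝓘(ℝ, V) 𝓘(ℝ, V) (extChartAt 𝓘(ℝ, V) x) y :=
    mdifferentiableAt_extChartAt (by simpa using hy)
  have h4 : h =ᶠ[𝓝 y] (h ∘ (extChartAt 𝓘(ℝ, V) x).symm) ∘ extChartAt 𝓘(ℝ, V) x := by
    filter_upwards [(isOpen_extChartAt_source x).mem_nhds hy] with z hz
    exact (congrArg h ((extChartAt 𝓘(ℝ, V) x).left_inv hz)).symm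
  have h5 : mfderiv 𝓘(ℝ, V) 𝓘(ℝ, F) h y = _ := h4.mfderiv_eq.trans (mfderiv_comp y h1 h2)
  rw [mfderiv_eq_fderiv] at h5
  exact congrArg (fun T => T ξ) h5

-- The pullback of a vector field to the chart is defined by the left side; the right side is what
-- the chain rule produces.
omit [FiniteDimensional ℝ V] in
theorem inverse_mfderivWithin_extChartAt_symm (x : M) {y : M}
    (hy : y ∈ (extChartAt 𝓘(ℝ, V) x).source) (ξ : TangentSpace 𝓘(ℝ, V) y) :
    (mfderivWithin 𝓘(ℝ, V) 𝓘(ℝ, V) (extChartAt 𝓘(ℝ, V) x).symm (range 𝓘(ℝ, V))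
      (extChartAt 𝓘(ℝ, V) x y)).inverse ξ =
      mfderiv 𝓘(ℝ, V) 𝓘(ℝ, V) (extChartAt 𝓘(ℝ, V) x) y ξ := by
  have h1 := isInvertible_mfderivWithin_extChartAt_symm (I := 𝓘(ℝ, V))
    ((extChartAt 𝓘(ℝ, V) x).map_source hy)
  have h2 := congrArg (fun T => T ξ)
    (mfderivWithin_extChartAt_symm_comp_mfderiv_extChartAt' (I := 𝓘(ℝ, V)) hy)
  have h3 := h1.inverse_apply_self (mfderiv 𝓘(ℝ, V) 𝓘(ℝ, V) (extChartAt 𝓘(ℝ, V) x) y ξ)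
  exact (congrArg _ h2.symm).trans h3

open VectorField in
/-- The Lie bracket of vector fields acts on functions as a commutator. -/
theorem dirDeriv_mlieBracket {X Y : Π x : M, TangentSpace 𝓘(ℝ, V) x}
    (hX : IsSmoothField X) (hY : IsSmoothField Y) {f : M → F}
    (hf : ContMDiff 𝓘(ℝ, V) 𝓘(ℝ, F) ∞ f) (x : M) :
    dirDeriv f x (mlieBracket 𝓘(ℝ, V) X Y x) =
      dirDeriv (fun y => dirDeriv f y (Y y)) x (X x)
        - dirDeriv (fun y => dirDeriv f y (X y)) x (Y x) := by
  have h2 : (2 : ℕ∞ω) ≤ ∞ := WithTop.coe_le_coe.2 (le_top : (2 : ℕ∞) ≤ ⊤)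
  have : IsManifold 𝓘(ℝ, V) 2 M := IsManifold.of_le h2
  set φ := extChartAt 𝓘(ℝ, V) x with hφ
  have hx : x ∈ φ.source := mem_extChartAt_source x
  have hfs : ContDiffAt ℝ ∞ (f ∘ φ.symm) (φ x) := by
    have h1 : ContMDiffAt 𝓘(ℝ, V) 𝓘(ℝ, V) ∞ φ.symm (φ x) :=
      (contMDiffOn_extChartAt_symm x).contMDiffAt (extChartAt_target_mem_nhds x)
    exact ((hf _).comp _ h1).contDiffAt
  -- `P Z` is the field `Z` read in the chart at `x`.
  let P (Z : Π x : M, TangentSpace 𝓘(ℝ, V) x) : V → V :=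
    mpullbackWithin 𝓘(ℝ, V) 𝓘(ℝ, V) φ.symm Z (range 𝓘(ℝ, V))
  have hP (Z : Π x : M, TangentSpace 𝓘(ℝ, V) x) {y : M} (hy : y ∈ φ.source) :
      P Z (φ y) = mfderiv 𝓘(ℝ, V) 𝓘(ℝ, V) φ y (Z y) := by
    have h1 : φ.symm (φ y) = y := φ.left_inv hy
    have h2 := inverse_mfderivWithin_extChartAt_symm x hy (Z y)
    rw [← h2]
    simp only [P, mpullbackWithin_apply]
    congr 1
    rw [h1]
  have huniv : φ.symm ⁻¹' univ ∩ range 𝓘(ℝ, V) = univ := by simp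
  have hPd {Z : Π x : M, TangentSpace 𝓘(ℝ, V) x} (hZ : IsSmoothField Z) :
      DifferentiableAt ℝ (P Z) (φ x) := by
    have h1 := MDifferentiableWithinAt.differentiableWithinAt_mpullbackWithin_vectorField
      (((hZ x).mdifferentiableAt (by simp)).mdifferentiableWithinAt (s := univ))
    rw [huniv] at h1
    exact h1.differentiableAt univ_mem
  have hD (Z : Π x : M, TangentSpace 𝓘(ℝ, V) x) {h : M → F} {y : M} (hy : y ∈ φ.source)
      (hh : MDifferentiableAt 𝓘(ℝ, V) 𝓘(ℝ, F) h y) :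
      dirDeriv h y (Z y) = fderiv ℝ (h ∘ φ.symm) (φ y) (P Z (φ y)) := by
    rw [hP Z hy]
    exact mvfderiv_eq_fderiv_extChartAt x hy hh (Z y)
  have hDD {Z W : Π x : M, TangentSpace 𝓘(ℝ, V) x} (hW : IsSmoothField W) :
      dirDeriv (fun y => dirDeriv f y (W y)) x (Z x) =
        fderiv ℝ (fun z => fderiv ℝ (f ∘ φ.symm) z (P W z)) (φ x) (P Z (φ x)) := by
    rw [hD Z hx (mdifferentiableAt_of_contMDiff (hW.contMDiff_dirDeriv hf) x)]
    congr 1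
    refine Filter.EventuallyEq.fderiv_eq ?_
    filter_upwards [extChartAt_target_mem_nhds x] with z hz
    have h1 := hD W (φ.map_target hz) (mdifferentiableAt_of_contMDiff hf _)
    rw [φ.right_inv hz] at h1
    exact h1
  -- In the chart, symmetry of the second derivative of `f ∘ φ.symm` cancels the second-order terms
  -- of the commutator.
  rw [hDD hY, hDD hX, ← fderiv_apply_lieBracket_of_isSymmSndFDerivAt (hfs.of_le h2)
    (hfs.isSymmSndFDerivAt (by simpa using h2)) (hPd hY) (hPd hX)]
  have h1 : mlieBracket 𝓘(ℝ, V) X Y x =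
      (mfderiv 𝓘(ℝ, V) 𝓘(ℝ, V) φ x).inverse (lieBracket ℝ (P X) (P Y) (φ x) : V) := by
    rw [← lieBracketWithin_univ, ← huniv]
    exact mlieBracketWithin_apply
  rw [h1, dirDeriv, mvfderiv_eq_fderiv_extChartAt x hx (mdifferentiableAt_of_contMDiff hf x)]
  congr 1
  exact (isInvertible_mfderiv_extChartAt hx).self_apply_inverse _

end Manifold

/-! ### Linear algebra of the `g`-orthogonal projection onto the range of an injective map -/

section MetricOperator

variable {V : Type*} [NormedAddCommGroup V] [NormedSpace ℝ V]
  {E : Type*} [NormedAddCommGroup E] [InnerProductSpace ℝ E]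

/-- The map `w ↦ (v ↦ ⟪g w, A v⟫)` from the ambient space to the dual of the source of `A`. -/
noncomputable def pairingMap (A : V →L[ℝ] E) (g : E →L[ℝ] E) : E →L[ℝ] V →L[ℝ] ℝ :=
  (A.precomp ℝ) ∘L (innerSL ℝ : E →L[ℝ] E →L[ℝ] ℝ) ∘L g

@[simp]
theorem pairingMap_apply (A : V →L[ℝ] E) (g : E →L[ℝ] E) (w : E) (v : V) :
    pairingMap A g w v = ⟪g w, A v⟫_ℝ := rfl

/-- The coordinates with respect to `A` of the projection onto the range of `A` that is orthogonal
for `⟪·, g ·⟫`. -/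
noncomputable def leftInv (A : V →L[ℝ] E) (g : E →L[ℝ] E) : E →L[ℝ] V :=
  (pairingMap A g ∘L A).inverse ∘L pairingMap A g

/-- The form `⟪g (A v), A v'⟫` is positive definite, so the map to the dual is injective, and the
dimensions agree. -/
theorem isInvertible_pairingMap_comp [FiniteDimensional ℝ V] {A : V →L[ℝ] E} {g : E →L[ℝ] E}
    (hA : Function.Injective A) (hg : ∀ w, w ≠ 0 → 0 < ⟪w, g w⟫_ℝ) :
    (pairingMap A g ∘L A).IsInvertible := by
  have hinj : Function.Injective (pairingMap A g ∘L A : V →L[ℝ] V →L[ℝ] ℝ).toLinearMap := by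
    refine (injective_iff_map_eq_zero _).2 fun v hv => ?_
    by_contra h
    have h1 : A v ≠ 0 := fun h0 => h (hA (h0.trans (map_zero A).symm))
    have h2 : pairingMap A g (A v) v = 0 := congrArg (fun l : V →L[ℝ] ℝ => l v) hv
    rw [pairingMap_apply, real_inner_comm] at h2
    exact (hg _ h1).ne' h2
  have hdim : Module.finrank ℝ V = Module.finrank ℝ (V →L[ℝ] ℝ) := by
    rw [← (LinearMap.toContinuousLinearMap : (V →ₗ[ℝ] ℝ) ≃ₗ[ℝ] (V →L[ℝ] ℝ)).finrank_eq]
    exact (Subspace.dual_finrank_eq (K := ℝ) (V := V)).symm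
  have : FiniteDimensional ℝ (V →L[ℝ] ℝ) :=
    (LinearMap.toContinuousLinearMap : (V →ₗ[ℝ] ℝ) ≃ₗ[ℝ] (V →L[ℝ] ℝ)).finiteDimensional
  exact ⟨(LinearEquiv.ofInjectiveOfFinrankEq _ hinj hdim).toContinuousLinearEquiv, rfl⟩

theorem leftInv_apply_self [FiniteDimensional ℝ V] {A : V →L[ℝ] E} {g : E →L[ℝ] E}
    (hA : Function.Injective A) (hg : ∀ w, w ≠ 0 → 0 < ⟪w, g w⟫_ℝ) (v : V) :
    leftInv A g (A v) = v :=
  (isInvertible_pairingMap_comp hA hg).inverse_apply_self v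

theorem inner_apply_sub_leftInv [FiniteDimensional ℝ V] {A : V →L[ℝ] E} {g : E →L[ℝ] E}
    (hA : Function.Injective A) (hg : ∀ w, w ≠ 0 → 0 < ⟪w, g w⟫_ℝ) (w : E) (v : V) :
    ⟪g (w - A (leftInv A g w)), A v⟫_ℝ = 0 := by
  have h1 := (isInvertible_pairingMap_comp hA hg).self_apply_inverse (pairingMap A g w)
  have h2 : pairingMap A g (w - A (leftInv A g w)) = 0 := by
    rw [map_sub, sub_eq_zero]
    exact h1.symm
  have h3 := congrArg (fun l : V →L[ℝ] ℝ => l v) h2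
  exact h3

variable {H M : Type*} [NormedAddCommGroup H] [NormedSpace ℝ H] [TopologicalSpace M]
  [ChartedSpace H M]

theorem contMDiffAt_pairingMap {A : M → V →L[ℝ] E} {g : M → E →L[ℝ] E} {x : M}
    (hA : ContMDiffAt 𝓘(ℝ, H) 𝓘(ℝ, V →L[ℝ] E) ∞ A x)
    (hg : ContMDiffAt 𝓘(ℝ, H) 𝓘(ℝ, E →L[ℝ] E) ∞ g x) :
    ContMDiffAt 𝓘(ℝ, H) 𝓘(ℝ, E →L[ℝ] V →L[ℝ] ℝ) ∞ (fun y => pairingMap (A y) (g y)) x := by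
  exact ContMDiffAt.clm_comp hA.clm_precomp (contMDiffAt_const.clm_comp hg)

/-- Operator inversion is smooth at invertible operators, so injectivity and positivity are needed
only at `x`. -/
theorem contMDiffAt_leftInv [FiniteDimensional ℝ V] {A : M → V →L[ℝ] E} {g : M → E →L[ℝ] E} {x : M}
    (hA : ContMDiffAt 𝓘(ℝ, H) 𝓘(ℝ, V →L[ℝ] E) ∞ A x)
    (hg : ContMDiffAt 𝓘(ℝ, H) 𝓘(ℝ, E →L[ℝ] E) ∞ g x)
    (hAx : Function.Injective (A x)) (hgx : ∀ w, w ≠ 0 → 0 < ⟪w, g x w⟫_ℝ) :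
    ContMDiffAt 𝓘(ℝ, H) 𝓘(ℝ, E →L[ℝ] V) ∞ (fun y => leftInv (A y) (g y)) x := by
  have : CompleteSpace V := FiniteDimensional.complete ℝ V
  have hB := contMDiffAt_pairingMap hA hg
  refine ContMDiffAt.clm_comp ?_ hB
  exact ((isInvertible_pairingMap_comp hAx hgx).contDiffAt_map_inverse).contMDiffAt.comp x
    (hB.clm_comp hA)

end MetricOperator

/-! ### Derivatives and tangent vectors in chart coordinates -/

section Chart

variable {V : Type*} [NormedAddCommGroup V] [NormedSpace ℝ V]
  {M : Type*} [TopologicalSpace M] [ChartedSpace V M] [IsManifold 𝓘(ℝ, V) ∞ M]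
  {F : Type*} [NormedAddCommGroup F] [NormedSpace ℝ F]

/-- The derivative of `f` in the preferred chart at `x₀`, at the point of the chart given by `y`. -/
noncomputable def chartDeriv (V : Type*) [NormedAddCommGroup V] [NormedSpace ℝ V] [ChartedSpace V M]
    (f : M → F) (x₀ y : M) : V →L[ℝ] F :=
  fderiv ℝ (f ∘ (extChartAt 𝓘(ℝ, V) x₀).symm) (extChartAt 𝓘(ℝ, V) x₀ y)

/-- The coordinates of tangent vectors at `y` in the preferred chart at `x₀`. -/
noncomputable def chartCoord (V : Type*) [NormedAddCommGroup V] [NormedSpace ℝ V] [ChartedSpace V M]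
    (x₀ y : M) : TangentSpace 𝓘(ℝ, V) y →L[ℝ] V :=
  mvfderiv 𝓘(ℝ, V) (extChartAt 𝓘(ℝ, V) x₀) y

theorem dirDeriv_eq_chartDeriv {f : M → F} (hf : ContMDiff 𝓘(ℝ, V) 𝓘(ℝ, F) ∞ f) {x₀ y : M}
    (hy : y ∈ (extChartAt 𝓘(ℝ, V) x₀).source) (ξ : TangentSpace 𝓘(ℝ, V) y) :
    dirDeriv f y ξ = chartDeriv V f x₀ y (chartCoord V x₀ y ξ) :=
  mvfderiv_eq_fderiv_extChartAt x₀ hy (mdifferentiableAt_of_contMDiff hf y) ξ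

theorem chartCoord_bijective {x₀ y : M} (hy : y ∈ (extChartAt 𝓘(ℝ, V) x₀).source) :
    Function.Bijective (chartCoord V x₀ y) := by
  have : IsManifold 𝓘(ℝ, V) 1 M := IsManifold.of_le (n := ∞) (by simp)
  exact (isInvertible_mfderiv_extChartAt hy).bijective

theorem contMDiffAt_chartDeriv {f : M → F} (hf : ContMDiff 𝓘(ℝ, V) 𝓘(ℝ, F) ∞ f) (x₀ : M) :
    ContMDiffAt 𝓘(ℝ, V) 𝓘(ℝ, V →L[ℝ] F) ∞ (chartDeriv V f x₀) x₀ := by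
  have h1 : ContMDiffAt 𝓘(ℝ, V) 𝓘(ℝ, V) ∞ (extChartAt 𝓘(ℝ, V) x₀).symm
      (extChartAt 𝓘(ℝ, V) x₀ x₀) :=
    (contMDiffOn_extChartAt_symm x₀).contMDiffAt (extChartAt_target_mem_nhds x₀)
  have h2 : ContDiffAt ℝ ∞ (f ∘ (extChartAt 𝓘(ℝ, V) x₀).symm) (extChartAt 𝓘(ℝ, V) x₀ x₀) :=
    ((hf _).comp _ h1).contDiffAt
  exact (h2.fderiv_right (m := ∞) (by simp)).contMDiffAt.comp x₀ contMDiffAt_extChartAt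

/-- The tangent bundle trivialization at `x₀` is the derivative of the chart at `x₀`. -/
theorem isSmoothField_of_chartCoord {W : Π x : M, TangentSpace 𝓘(ℝ, V) x}
    (h : ∀ x₀, ContMDiffAt 𝓘(ℝ, V) 𝓘(ℝ, V) ∞ (fun y => chartCoord V x₀ y (W y)) x₀) :
    IsSmoothField W := by
  have : IsManifold 𝓘(ℝ, V) 1 M := IsManifold.of_le (n := ∞) (by simp)
  intro x₀
  rw [contMDiffAt_section]
  refine (h x₀).congr_of_eventuallyEq ?_
  filter_upwards [extChartAt_source_mem_nhds (I := 𝓘(ℝ, V)) x₀] with y hy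
  have hy' : y ∈ (chartAt V x₀).source := by simpa using hy
  have h1 := TangentBundle.continuousLinearMapAt_trivializationAt (I := 𝓘(ℝ, V)) hy'
  have h2 := congrArg (fun T => T (W y)) h1
  refine Eq.trans ?_ h2
  rw [Trivialization.continuousLinearMapAt_apply, Trivialization.linearMapAt_apply, if_pos]
  simpa using hy'

end Chart

/-! ### Product rules for directional derivatives -/

section Product

variable {V : Type*} [NormedAddCommGroup V] [NormedSpace ℝ V]
  {M : Type*} [TopologicalSpace M] [ChartedSpace V M] [IsManifold 𝓘(ℝ, V) ∞ M]
  {F : Type*} [NormedAddCommGroup F] [NormedSpace ℝ F]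
  {G : Type*} [NormedAddCommGroup G] [NormedSpace ℝ G]
  {H : Type*} [NormedAddCommGroup H] [NormedSpace ℝ H]

theorem differentiableAt_comp_extChartAt_symm {f : M → F}
    (hf : ContMDiff 𝓘(ℝ, V) 𝓘(ℝ, F) ∞ f) (x : M) :
    DifferentiableAt ℝ (f ∘ (extChartAt 𝓘(ℝ, V) x).symm) (extChartAt 𝓘(ℝ, V) x x) := by
  have h1 : ContMDiffAt 𝓘(ℝ, V) 𝓘(ℝ, V) ∞ (extChartAt 𝓘(ℝ, V) x).symm
      (extChartAt 𝓘(ℝ, V) x x) :=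
    (contMDiffOn_extChartAt_symm x).contMDiffAt (extChartAt_target_mem_nhds x)
  exact ((hf _).comp _ h1).contDiffAt.differentiableAt (by simp)

/-- The product rule for the application of operator-valued functions. -/
theorem dirDeriv_clm_apply {B : M → F →L[ℝ] G} {a : M → F}
    (hB : ContMDiff 𝓘(ℝ, V) 𝓘(ℝ, F →L[ℝ] G) ∞ B) (ha : ContMDiff 𝓘(ℝ, V) 𝓘(ℝ, F) ∞ a)
    (x : M) (ξ : TangentSpace 𝓘(ℝ, V) x) :
    dirDeriv (fun y => B y (a y)) x ξ = dirDeriv B x ξ (a x) + B x (dirDeriv a x ξ) := by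
  have hx := mem_extChartAt_source (I := 𝓘(ℝ, V)) x
  have h1 := fderiv_clm_apply (differentiableAt_comp_extChartAt_symm hB x)
    (differentiableAt_comp_extChartAt_symm ha x)
  rw [dirDeriv_eq_chartDeriv (hB.clm_apply ha) hx, dirDeriv_eq_chartDeriv hB hx,
    dirDeriv_eq_chartDeriv ha hx]
  have h2 := congrArg (fun T => T (chartCoord V x x ξ)) h1
  refine Eq.trans h2 ?_
  simp [chartDeriv, add_comm]

theorem dirDeriv_bilinear_apply {B : M → F →L[ℝ] G →L[ℝ] H} {a : M → F} {b : M → G}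
    (hB : ContMDiff 𝓘(ℝ, V) 𝓘(ℝ, F →L[ℝ] G →L[ℝ] H) ∞ B)
    (ha : ContMDiff 𝓘(ℝ, V) 𝓘(ℝ, F) ∞ a) (hb : ContMDiff 𝓘(ℝ, V) 𝓘(ℝ, G) ∞ b)
    (x : M) (ξ : TangentSpace 𝓘(ℝ, V) x) :
    dirDeriv (fun y => B y (a y) (b y)) x ξ =
      dirDeriv B x ξ (a x) (b x) + B x (dirDeriv a x ξ) (b x) + B x (a x) (dirDeriv b x ξ) := by
  rw [dirDeriv_clm_apply (hB.clm_apply ha) hb, dirDeriv_clm_apply hB ha]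
  simp

omit [IsManifold 𝓘(ℝ, V) ∞ M] in
theorem dirDeriv_add {f h : M → F} (hf : ContMDiff 𝓘(ℝ, V) 𝓘(ℝ, F) ∞ f)
    (hh : ContMDiff 𝓘(ℝ, V) 𝓘(ℝ, F) ∞ h) (x : M) (ξ : TangentSpace 𝓘(ℝ, V) x) :
    dirDeriv (fun y => f y + h y) x ξ = dirDeriv f x ξ + dirDeriv h x ξ := by
  rw [dirDeriv, mvfderiv_fun_add (mdifferentiableAt_of_contMDiff hf x)
    (mdifferentiableAt_of_contMDiff hh x)]
  rfl

end Product

/-! ### Smoothness of the metric projection and existence of the ring Christoffel function -/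

section Projection

variable {V : Type*} [NormedAddCommGroup V] [NormedSpace ℝ V] [FiniteDimensional ℝ V]
  {M : Type*} [TopologicalSpace M] [ChartedSpace V M] [IsManifold 𝓘(ℝ, V) ∞ M]
  [RiemannianBundle (fun x : M => TangentSpace 𝓘(ℝ, V) x)]
  {E : Type*} [NormedAddCommGroup E] [InnerProductSpace ℝ E] [FiniteDimensional ℝ E]
  {ι : M → E} {g : M → E →L[ℝ] E}

-- A vector killed by `dι` has Riemannian length zero, since `g` induces the metric.
omit [FiniteDimensional ℝ V] [IsManifold 𝓘(ℝ, V) ∞ M] [FiniteDimensional ℝ E] in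
theorem IsMetricOperator.dirDeriv_injective (hg : IsMetricOperator (V := V) ι g) (x : M) :
    Function.Injective (dirDeriv (V := V) ι x) := by
  refine (injective_iff_map_eq_zero _).2 fun ξ hξ => ?_
  have h1 := hg.induces x ξ ξ
  have h2 : dirDeriv ι x ξ = 0 := hξ
  rw [h2, inner_zero_left] at h1
  exact inner_self_eq_zero.1 h1

omit [FiniteDimensional ℝ V] [FiniteDimensional ℝ E] in
theorem IsMetricOperator.chartDeriv_injective (hg : IsMetricOperator (V := V) ι g)
    (hι : ContMDiff 𝓘(ℝ, V) 𝓘(ℝ, E) ∞ ι) {x₀ y : M}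
    (hy : y ∈ (extChartAt 𝓘(ℝ, V) x₀).source) : Function.Injective (chartDeriv V ι x₀ y) := by
  intro v₁ v₂ h
  obtain ⟨ξ₁, rfl⟩ := (chartCoord_bijective hy).2 v₁
  obtain ⟨ξ₂, rfl⟩ := (chartCoord_bijective hy).2 v₂
  rw [← dirDeriv_eq_chartDeriv hι hy, ← dirDeriv_eq_chartDeriv hι hy] at h
  rw [hg.dirDeriv_injective y h]

/-- The coordinates, in the preferred chart at `x₀`, of the projection onto the tangent space
at `y`. -/
noncomputable def chartProj (V : Type*) [NormedAddCommGroup V] [NormedSpace ℝ V]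
    [ChartedSpace V M] (ι : M → E) (g : M → E →L[ℝ] E) (x₀ y : M) : E →L[ℝ] V :=
  leftInv (chartDeriv V ι x₀ y) (g y)

omit [FiniteDimensional ℝ E] in
theorem IsMetricOperator.chartProj_dirDeriv (hg : IsMetricOperator (V := V) ι g)
    (hι : ContMDiff 𝓘(ℝ, V) 𝓘(ℝ, E) ∞ ι) {x₀ y : M}
    (hy : y ∈ (extChartAt 𝓘(ℝ, V) x₀).source) (ξ : TangentSpace 𝓘(ℝ, V) y) :
    chartProj V ι g x₀ y (dirDeriv ι y ξ) = chartCoord V x₀ y ξ := by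
  rw [dirDeriv_eq_chartDeriv hι hy]
  exact leftInv_apply_self (hg.chartDeriv_injective hι hy) (hg.pos y) _

omit [FiniteDimensional ℝ E] in
theorem IsMetricOperator.contMDiffAt_chartProj (hg : IsMetricOperator (V := V) ι g)
    (hι : ContMDiff 𝓘(ℝ, V) 𝓘(ℝ, E) ∞ ι) (x₀ : M) :
    ContMDiffAt 𝓘(ℝ, V) 𝓘(ℝ, E →L[ℝ] V) ∞ (chartProj V ι g x₀) x₀ :=
  contMDiffAt_leftInv (contMDiffAt_chartDeriv hι x₀) (hg.smooth x₀)
    (hg.chartDeriv_injective hι (mem_extChartAt_source x₀)) (hg.pos x₀)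

theorem IsMetricOperator.metricProjection_eq (hg : IsMetricOperator (V := V) ι g)
    (hι : ContMDiff 𝓘(ℝ, V) 𝓘(ℝ, E) ∞ ι) {x₀ y : M}
    (hy : y ∈ (extChartAt 𝓘(ℝ, V) x₀).source) :
    metricProjection (V := V) ι g y = chartDeriv V ι x₀ y ∘L chartProj V ι g x₀ y := by
  ext w
  have hA := hg.chartDeriv_injective hι hy
  set A := chartDeriv V ι x₀ y with hAdef
  have hT (v : V) : A v ∈ ambientTangentSpace (V := V) ι y := by
    obtain ⟨ξ, rfl⟩ := (chartCoord_bijective hy).2 v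
    exact ⟨ξ, dirDeriv_eq_chartDeriv hι hy ξ⟩
  have hP := metricProjection_mem (V := V) ι g y w
  have hd := Submodule.sub_mem _ hP (hT (chartProj V ι g x₀ y w))
  -- The difference `d` of the two candidate projections is tangent and also `g`-orthogonal to
  -- tangent vectors, so `⟪d, g d⟫ = 0`.
  set d := metricProjection (V := V) ι g y w - A (chartProj V ι g x₀ y w) with hddef
  suffices h : d = 0 from sub_eq_zero.1 h
  by_contra hne
  refine (hg.pos y d hne).ne' ?_
  obtain ⟨ξ, hξ⟩ := hd
  have h1 : A (chartCoord V x₀ y ξ) = d := (dirDeriv_eq_chartDeriv hι hy ξ).symm.trans hξ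
  have h2 := inner_apply_sub_leftInv hA (hg.pos y) w (chartCoord V x₀ y ξ)
  rw [h1, hg.selfAdjoint] at h2
  have h3 := metricProjection_orthogonal (V := V) ι g y (hg.pos y) w d ⟨ξ, hξ⟩
  have h4 : d = (w - A (leftInv A (g y) w)) - (w - metricProjection (V := V) ι g y w) := by
    rw [hddef, chartProj]; abel
  calc ⟪d, g y d⟫_ℝ = ⟪(w - A (leftInv A (g y) w)) - (w - metricProjection (V := V) ι g y w),
        g y d⟫_ℝ := by rw [← h4]
    _ = 0 := by rw [inner_sub_left, h2, h3, sub_zero]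

theorem IsMetricOperator.contMDiff_metricProjection (hg : IsMetricOperator (V := V) ι g)
    (hι : ContMDiff 𝓘(ℝ, V) 𝓘(ℝ, E) ∞ ι) :
    ContMDiff 𝓘(ℝ, V) 𝓘(ℝ, E →L[ℝ] E) ∞ (metricProjection (V := V) ι g) := by
  intro x₀
  refine ((contMDiffAt_chartDeriv hι x₀).clm_comp
    (hg.contMDiffAt_chartProj hι x₀)).congr_of_eventuallyEq ?_
  filter_upwards [extChartAt_source_mem_nhds (I := 𝓘(ℝ, V)) x₀] with y hy
  exact hg.metricProjection_eq hι hy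

omit [FiniteDimensional ℝ E] in
/-- A vector field is smooth if it is smooth as a function with values in the ambient space. -/
theorem IsMetricOperator.isSmoothField (hg : IsMetricOperator (V := V) ι g)
    (hι : ContMDiff 𝓘(ℝ, V) 𝓘(ℝ, E) ∞ ι) {W : Π x : M, TangentSpace 𝓘(ℝ, V) x}
    (hW : ContMDiff 𝓘(ℝ, V) 𝓘(ℝ, E) ∞ (ambientField ι W)) : IsSmoothField W := by
  refine isSmoothField_of_chartCoord fun x₀ => ?_
  -- The coordinates of `W` are recovered from its ambient values by the smooth left inverse
  -- `chartProj`.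
  refine ((hg.contMDiffAt_chartProj hι x₀).clm_apply (hW x₀)).congr_of_eventuallyEq ?_
  filter_upwards [extChartAt_source_mem_nhds (I := 𝓘(ℝ, V)) x₀] with y hy
  exact (hg.chartProj_dirDeriv hι hy (W y)).symm

/-- Lifts `Π_x` to an intrinsic tangent vector, so that differentiation in the direction `Π_x w`
makes sense. -/
theorem IsMetricOperator.exists_tangentProj (hg : IsMetricOperator (V := V) ι g)
    (hι : ContMDiff 𝓘(ℝ, V) 𝓘(ℝ, E) ∞ ι) (x : M) :
    ∃ P : E →L[ℝ] TangentSpace 𝓘(ℝ, V) x,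
      ∀ w, dirDeriv ι x (P w) = metricProjection (V := V) ι g x w := by
  have : IsManifold 𝓘(ℝ, V) 1 M := IsManifold.of_le (n := ∞) (by simp)
  have hx := mem_extChartAt_source (I := 𝓘(ℝ, V)) x
  refine ⟨(chartCoord V x x).inverse ∘L chartProj V ι g x x, fun w => ?_⟩
  rw [dirDeriv_eq_chartDeriv hι hx, hg.metricProjection_eq hι hx]
  exact congrArg (chartDeriv V ι x x)
    ((isInvertible_mfderiv_extChartAt hx).self_apply_inverse (chartProj V ι g x x w))

set_option synthInstance.maxHeartbeats 200000 in
theorem IsMetricOperator.exists_isRingChristoffel (hg : IsMetricOperator (V := V) ι g)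
    (hι : ContMDiff 𝓘(ℝ, V) 𝓘(ℝ, E) ∞ ι) {Γ : M → E →L[ℝ] E →L[ℝ] E}
    (hΓ : ContMDiff 𝓘(ℝ, V) 𝓘(ℝ, E →L[ℝ] E →L[ℝ] E) ∞ Γ) :
    ∃ Γ', IsRingChristoffel (V := V) ι g Γ Γ' := by
  choose P hP using hg.exists_tangentProj hι
  have hproj := hg.contMDiff_metricProjection hι
  -- Precomposing with `P` extends `ζ ↦ D_ζ Π` from tangent vectors to all of `E`. The choice of `P`
  -- does not hinder smoothness: its chart coordinates are `chartProj`.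
  refine ⟨fun x => mvfderiv 𝓘(ℝ, V) (metricProjection (V := V) ι g) x ∘L P x + Γ x, ?_, ?_⟩
  · refine ContMDiff.add (fun x₀ => ?_) hΓ
    refine ((contMDiffAt_chartDeriv hproj x₀).clm_comp
      (hg.contMDiffAt_chartProj hι x₀)).congr_of_eventuallyEq ?_
    filter_upwards [extChartAt_source_mem_nhds (I := 𝓘(ℝ, V)) x₀] with y hy
    ext1 w
    have h1 : chartCoord V x₀ y (P y w) = chartProj V ι g x₀ y w := by
      rw [← hg.chartProj_dirDeriv hι hy, hP, hg.metricProjection_eq hι hy]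
      exact leftInv_apply_self (hg.chartDeriv_injective hι hy) (hg.pos y) _
    refine (dirDeriv_eq_chartDeriv hproj hy (P y w)).trans ?_
    rw [h1]
    rfl
  · intro x ξ w
    have h1 : P x (dirDeriv ι x ξ) = ξ := by
      refine hg.dirDeriv_injective x ?_
      have hx := mem_extChartAt_source (I := 𝓘(ℝ, V)) x
      rw [hP, hg.metricProjection_eq hι hx, ContinuousLinearMap.comp_apply,
        hg.chartProj_dirDeriv hι hx, dirDeriv_eq_chartDeriv hι hx]
    have h2 := congrArg (fun ζ => dirDeriv (metricProjection (V := V) ι g) x ζ w) h1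
    exact congrArg (· + Γ x (dirDeriv ι x ξ) w) h2

end Projection

/-! ### Curvature through Christoffel functions -/

section Curvature

variable {V : Type*} [NormedAddCommGroup V] [NormedSpace ℝ V] [FiniteDimensional ℝ V]
  {M : Type*} [TopologicalSpace M] [ChartedSpace V M] [IsManifold 𝓘(ℝ, V) ∞ M]
  {E : Type*} [NormedAddCommGroup E] [InnerProductSpace ℝ E]
  {ι : M → E} {cov : Connection V M} {Γ : M → E →L[ℝ] E →L[ℝ] E}

theorem IsChristoffelFunction.dirDeriv_cov [T2Space M] [SigmaCompactSpace M]
    (hΓ : IsChristoffelFunction ι cov Γ) {Y : Π x : M, TangentSpace 𝓘(ℝ, V) x}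
    (hY : IsSmoothField Y) (x : M) (ξ : TangentSpace 𝓘(ℝ, V) x) :
    dirDeriv ι x (cov Y x ξ) =
      dirDeriv (ambientField ι Y) x ξ + Γ x (dirDeriv ι x ξ) (ambientField ι Y x) := by
  obtain ⟨X, hX, rfl⟩ := exists_isSmoothField_eq x ξ
  exact hΓ.eq X Y hX hY x

/-- Both `∇_X Y - ∇_Y X` and `D_X Y - D_Y X` equal `[X,Y]`, so the `Γ` terms must cancel. -/
theorem IsChristoffelFunction.symm_tangent [T2Space M] [SigmaCompactSpace M]
    (hΓ : IsChristoffelFunction ι cov Γ) (hι : ContMDiff 𝓘(ℝ, V) 𝓘(ℝ, E) ∞ ι)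
    (htor : cov.torsion = 0) (x : M) (ξ η : TangentSpace 𝓘(ℝ, V) x) :
    Γ x (dirDeriv ι x ξ) (dirDeriv ι x η) = Γ x (dirDeriv ι x η) (dirDeriv ι x ξ) := by
  obtain ⟨X, hX, rfl⟩ := exists_isSmoothField_eq x ξ
  obtain ⟨Y, hY, rfl⟩ := exists_isSmoothField_eq x η
  have h1 := (CovariantDerivative.torsion_eq_zero_iff cov).1 htor
    ((hX x).mdifferentiableAt (by simp)) ((hY x).mdifferentiableAt (by simp))
  have h2 : dirDeriv ι x (cov Y x (X x)) - dirDeriv ι x (cov X x (Y x)) =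
      dirDeriv ι x (VectorField.mlieBracket 𝓘(ℝ, V) X Y x) :=
    (map_sub _ _ _).symm.trans (congrArg (fun ζ => dirDeriv ι x ζ) h1)
  rw [hΓ.dirDeriv_cov hX, hΓ.dirDeriv_cov hY, dirDeriv_mlieBracket hX hY hι] at h2
  have h3 : ∀ a b c d : E, a + c - (b + d) = a - b → c = d := fun a b c d h => by
    rw [add_sub_add_comm] at h
    exact sub_eq_zero.1 (left_eq_add.1 h.symm)
  exact h3 _ _ _ _ h2

/-- The curvature of `∇` on vector fields in terms of a Christoffel function. -/
theorem IsChristoffelFunction.dirDeriv_fieldCurvature [T2Space M] [SigmaCompactSpace M]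
    (hΓ : IsChristoffelFunction ι cov Γ) (hι : ContMDiff 𝓘(ℝ, V) 𝓘(ℝ, E) ∞ ι)
    (hfield : ∀ W : Π x : M, TangentSpace 𝓘(ℝ, V) x,
      ContMDiff 𝓘(ℝ, V) 𝓘(ℝ, E) ∞ (ambientField ι W) → IsSmoothField W)
    {X Y Z : Π x : M, TangentSpace 𝓘(ℝ, V) x}
    (hX : IsSmoothField X) (hY : IsSmoothField Y) (hZ : IsSmoothField Z) (x : M) :
    dirDeriv ι x (fieldCurvature cov X Y Z x) =
      -(dirDeriv Γ x (X x)) (dirDeriv ι x (Y x)) (dirDeriv ι x (Z x))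
        + (dirDeriv Γ x (Y x)) (dirDeriv ι x (X x)) (dirDeriv ι x (Z x))
        - Γ x (dirDeriv ι x (X x)) (Γ x (dirDeriv ι x (Y x)) (dirDeriv ι x (Z x)))
        + Γ x (dirDeriv ι x (Y x)) (Γ x (dirDeriv ι x (X x)) (dirDeriv ι x (Z x))) := by
  have hcov {Y : Π x : M, TangentSpace 𝓘(ℝ, V) x} (hY : IsSmoothField Y) :
      ambientField ι (fun y => cov Z y (Y y)) = fun y =>
        dirDeriv (ambientField ι Z) y (Y y) + Γ y (ambientField ι Y y) (ambientField ι Z y) :=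
    funext fun y => hΓ.dirDeriv_cov hZ y (Y y)
  have hsm {Y : Π x : M, TangentSpace 𝓘(ℝ, V) x} (hY : IsSmoothField Y) :
      ContMDiff 𝓘(ℝ, V) 𝓘(ℝ, E) ∞ (ambientField ι Y) := hY.contMDiff_dirDeriv hι
  have hΓsm {Y : Π x : M, TangentSpace 𝓘(ℝ, V) x} (hY : IsSmoothField Y) :
      ContMDiff 𝓘(ℝ, V) 𝓘(ℝ, E) ∞ (fun y => Γ y (ambientField ι Y y) (ambientField ι Z y)) :=
    (hΓ.smooth.clm_apply (hsm hY)).clm_apply (hsm hZ)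
  -- The Christoffel identity can be applied to `∇_Y Z` only once this is a smooth field.
  have hcovsm {Y : Π x : M, TangentSpace 𝓘(ℝ, V) x} (hY : IsSmoothField Y) :
      IsSmoothField (fun y => cov Z y (Y y)) := by
    refine hfield _ ?_
    rw [hcov hY]
    exact (hY.contMDiff_dirDeriv (hsm hZ)).add (hΓsm hY)
  have hcc {X Y : Π x : M, TangentSpace 𝓘(ℝ, V) x} (hY : IsSmoothField Y) :
      dirDeriv ι x (cov (fun y => cov Z y (Y y)) x (X x)) =
        dirDeriv (fun y => dirDeriv (ambientField ι Z) y (Y y)) x (X x)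
          + (dirDeriv Γ x (X x) (ambientField ι Y x) (ambientField ι Z x)
            + Γ x (dirDeriv (ambientField ι Y) x (X x)) (ambientField ι Z x)
            + Γ x (ambientField ι Y x) (dirDeriv (ambientField ι Z) x (X x)))
          + (Γ x (ambientField ι X x) (dirDeriv (ambientField ι Z) x (Y x))
            + Γ x (ambientField ι X x) (Γ x (ambientField ι Y x) (ambientField ι Z x))) := by
    rw [hΓ.dirDeriv_cov (hcovsm hY), hcov hY,
      dirDeriv_add (hY.contMDiff_dirDeriv (hsm hZ)) (hΓsm hY),
      dirDeriv_bilinear_apply hΓ.smooth (hsm hY) (hsm hZ), map_add]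
    rfl
  have hb : dirDeriv ι x (VectorField.mlieBracket 𝓘(ℝ, V) X Y x) =
      dirDeriv (ambientField ι Y) x (X x) - dirDeriv (ambientField ι X) x (Y x) :=
    dirDeriv_mlieBracket hX hY hι x
  have h1 : dirDeriv ι x (fieldCurvature cov X Y Z x) =
      dirDeriv ι x (cov Z x (VectorField.mlieBracket 𝓘(ℝ, V) X Y x))
        - dirDeriv ι x (cov (fun y => cov Z y (Y y)) x (X x))
        + dirDeriv ι x (cov (fun y => cov Z y (X y)) x (Y x)) := by
    simp only [fieldCurvature, dirDeriv, map_add, map_sub]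
  -- With `[X,Y]` expanded as a commutator, every term containing a derivative of `X`, `Y` or `Z`
  -- cancels.
  rw [h1, hΓ.dirDeriv_cov hZ, dirDeriv_mlieBracket hX hY (hsm hZ), hb, hcc hX, hcc hY]
  simp only [map_sub, sub_apply]
  simp only [ambientField]
  abel

/-- The antisymmetric part of the derivative of a Christoffel function. -/
theorem IsChristoffelFunction.dirDeriv_sub_dirDeriv_flip [T2Space M] [SigmaCompactSpace M]
    (hΓ : IsChristoffelFunction ι cov Γ) (hι : ContMDiff 𝓘(ℝ, V) 𝓘(ℝ, E) ∞ ι)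
    (htor : cov.torsion = 0) (x : M) (ξ η φ : TangentSpace 𝓘(ℝ, V) x) :
    dirDeriv Γ x ξ (dirDeriv ι x η) (dirDeriv ι x φ)
        - dirDeriv Γ x ξ (dirDeriv ι x φ) (dirDeriv ι x η) =
      Γ x (Γ x (dirDeriv ι x ξ) (dirDeriv ι x η)) (dirDeriv ι x φ)
        - Γ x (dirDeriv ι x φ) (Γ x (dirDeriv ι x ξ) (dirDeriv ι x η))
        + Γ x (dirDeriv ι x η) (Γ x (dirDeriv ι x ξ) (dirDeriv ι x φ))
        - Γ x (Γ x (dirDeriv ι x ξ) (dirDeriv ι x φ)) (dirDeriv ι x η) := by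
  obtain ⟨Y, hY, rfl⟩ := exists_isSmoothField_eq x η
  obtain ⟨Z, hZ, rfl⟩ := exists_isSmoothField_eq x φ
  have hsm {Y : Π x : M, TangentSpace 𝓘(ℝ, V) x} (hY : IsSmoothField Y) :
      ContMDiff 𝓘(ℝ, V) 𝓘(ℝ, E) ∞ (ambientField ι Y) := hY.contMDiff_dirDeriv hι
  have h1 : (fun y => Γ y (ambientField ι Y y) (ambientField ι Z y)) =
      fun y => Γ y (ambientField ι Z y) (ambientField ι Y y) :=
    funext fun y => hΓ.symm_tangent hι htor y (Y y) (Z y)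
  have h2 := congrArg (fun f => dirDeriv f x ξ) h1
  simp only [dirDeriv_bilinear_apply hΓ.smooth (hsm hY) (hsm hZ),
    dirDeriv_bilinear_apply hΓ.smooth (hsm hZ) (hsm hY)] at h2
  -- Write `D_ξ Y = ∇_ξ Y - Γ(ξ, Y)`, and likewise for `Z`: the tangent parts `∇_ξ Y`, `∇_ξ Z` drop
  -- out by symmetry of `Γ`, leaving terms quadratic in `Γ`.
  have hY' := eq_sub_of_add_eq (hΓ.dirDeriv_cov hY x ξ).symm
  have hZ' := eq_sub_of_add_eq (hΓ.dirDeriv_cov hZ x ξ).symm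
  have hs1 := hΓ.symm_tangent hι htor x (cov Y x ξ) (Z x)
  have hs2 := hΓ.symm_tangent hι htor x (Y x) (cov Z x ξ)
  rw [hY', hZ'] at h2
  simp only [ambientField, map_sub, sub_apply] at h2
  rw [hs1, hs2] at h2
  rw [← sub_eq_zero] at h2 ⊢
  rw [← h2]
  abel

/-- For a function `S` of the form `S(ξ) = D_ξ P`, the derivative of `S` is symmetric on tangent
vectors. -/
theorem dirDeriv_symm_of_eq_dirDeriv [T2Space M] [SigmaCompactSpace M]
    {F : Type*} [NormedAddCommGroup F] [NormedSpace ℝ F]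
    (hι : ContMDiff 𝓘(ℝ, V) 𝓘(ℝ, E) ∞ ι) {S : M → E →L[ℝ] F} {P : M → F}
    (hS : ContMDiff 𝓘(ℝ, V) 𝓘(ℝ, E →L[ℝ] F) ∞ S) (hP : ContMDiff 𝓘(ℝ, V) 𝓘(ℝ, F) ∞ P)
    (h : ∀ (x : M) (ξ : TangentSpace 𝓘(ℝ, V) x), S x (dirDeriv ι x ξ) = dirDeriv P x ξ)
    (x : M) (ξ η : TangentSpace 𝓘(ℝ, V) x) :
    dirDeriv S x ξ (dirDeriv ι x η) = dirDeriv S x η (dirDeriv ι x ξ) := by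
  obtain ⟨X, hX, rfl⟩ := exists_isSmoothField_eq x ξ
  obtain ⟨Y, hY, rfl⟩ := exists_isSmoothField_eq x η
  have h1 {X Y : Π x : M, TangentSpace 𝓘(ℝ, V) x} (hY : IsSmoothField Y) :
      -- Differentiate `D_Y P = S(Y)` along `X`. In the commutator, the terms `S(D_X Y - D_Y X)`
      -- account for `D_[X,Y] P`.
      dirDeriv (fun y => dirDeriv P y (Y y)) x (X x) =
        dirDeriv S x (X x) (ambientField ι Y x) + S x (dirDeriv (ambientField ι Y) x (X x)) := by
    have h2 : (fun y => dirDeriv P y (Y y)) = fun y => S y (ambientField ι Y y) :=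
      funext fun y => (h y (Y y)).symm
    rw [h2]
    exact dirDeriv_clm_apply hS (hY.contMDiff_dirDeriv hι) x (X x)
  have h2 := dirDeriv_mlieBracket hX hY hP x
  rw [h1 hY, h1 hX, ← h, dirDeriv_mlieBracket hX hY hι, map_sub] at h2
  have h3 : ∀ a b c d : F, a - b = c + a - (d + b) → c = d := fun a b c d h => by
    rw [add_sub_add_comm] at h
    exact sub_eq_zero.1 (right_eq_add.1 h)
  exact h3 _ _ _ _ h2

end Curvature

end EmbeddedCurvature

/-! ### Assembly of the curvature formulas -/

theorem mainTheorem1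
    {V : Type*} [NormedAddCommGroup V] [NormedSpace ℝ V] [FiniteDimensional ℝ V]
    {M : Type*} [TopologicalSpace M] [ChartedSpace V M] [IsManifold 𝓘(ℝ, V) ∞ M]
    [RiemannianBundle (fun x : M => TangentSpace 𝓘(ℝ, V) x)]
    [IsContMDiffRiemannianBundle 𝓘(ℝ, V) ∞ V (fun x : M => TangentSpace 𝓘(ℝ, V) x)]
    {E : Type*} [NormedAddCommGroup E] [InnerProductSpace ℝ E] [FiniteDimensional ℝ E]
    (ι : M → E) (hι : Manifold.IsSmoothEmbedding 𝓘(ℝ, V) 𝓘(ℝ, E) ∞ ι)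
    (g : M → E →L[ℝ] E) (hg : IsMetricOperator (V := V) ι g)
    (cov : Connection V M) (hcov : IsLeviCivita cov)
    (Γ : M → E →L[ℝ] E →L[ℝ] E) (hΓ : IsChristoffelFunction ι cov Γ) :
    (∃ Γ', IsRingChristoffel (V := V) ι g Γ Γ') ∧
    ∀ (x : M) (ξ η φ : TangentSpace 𝓘(ℝ, V) x),
      -- `u`, `v`, `w` are `ξ`, `η`, `φ` regarded as elements of `E`
      let u : E := dirDeriv ι x ξ
      let v : E := dirDeriv ι x η
      let w : E := dirDeriv ι x φ
      ∃ R : TangentSpace 𝓘(ℝ, V) x, IsCurvature cov x ξ η φ R ∧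
        dirDeriv ι x R =
          -(dirDeriv Γ x ξ) v w + (dirDeriv Γ x η) u w - Γ x u (Γ x v w) + Γ x v (Γ x u w) ∧
        dirDeriv ι x R =
          -(dirDeriv Γ x ξ) w v + (dirDeriv Γ x η) w u - Γ x (Γ x w v) u + Γ x (Γ x w u) v ∧
        ((∀ (ζ : TangentSpace 𝓘(ℝ, V) x) (e : E),
            Γ x (dirDeriv ι x ζ) e = Γ x e (dirDeriv ι x ζ)) →
          dirDeriv ι x R =
            -(dirDeriv Γ x ξ) v w + (dirDeriv Γ x η) u w
              - Γ x (Γ x w v) u + Γ x (Γ x w u) v) ∧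
        ∀ Γ', IsRingChristoffel (V := V) ι g Γ Γ' →
          dirDeriv ι x R =
            -(dirDeriv Γ' x ξ) v w + (dirDeriv Γ' x η) u w
              - Γ x u (Γ x v w) + Γ x v (Γ x u w) := by
  have hιs : ContMDiff 𝓘(ℝ, V) 𝓘(ℝ, E) ∞ ι := hι.contMDiff
  -- The topological conditions for partitions of unity are inherited from `E` through the
  -- embedding, with local compactness from the finite-dimensional charts.
  have hT2 : T2Space M := hι.isEmbedding.t2Space
  have hσ : SigmaCompactSpace M := by
    have := hι.isEmbedding.secondCountableTopology
    have := ChartedSpace.locallyCompactSpace V M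
    infer_instance
  refine ⟨hg.exists_isRingChristoffel hιs hΓ.smooth, fun x ξ η φ => ?_⟩
  intro u v w
  obtain ⟨X, hX, hXx⟩ := exists_isSmoothField_eq x ξ
  obtain ⟨Y, hY, hYx⟩ := exists_isSmoothField_eq x η
  obtain ⟨Z, hZ, hZx⟩ := exists_isSmoothField_eq x φ
  have hR (X Y Z : Π x : M, TangentSpace 𝓘(ℝ, V) x) (hX : IsSmoothField X)
      (hY : IsSmoothField Y) (hZ : IsSmoothField Z) (hXx : X x = ξ) (hYx : Y x = η)
      (hZx : Z x = φ) : dirDeriv ι x (fieldCurvature cov X Y Z x) =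
        -(dirDeriv Γ x ξ) v w + (dirDeriv Γ x η) u w - Γ x u (Γ x v w) + Γ x v (Γ x u w) := by
    have h := hΓ.dirDeriv_fieldCurvature hιs (fun W hW => hg.isSmoothField hιs hW) hX hY hZ x
    rwa [hXx, hYx, hZx] at h
  have hRX := hR X Y Z hX hY hZ hXx hYx hZx
  have hsymm := hΓ.symm_tangent hιs hcov.torsionFree x
  have huv : Γ x u v = Γ x v u := hsymm ξ η
  have huw : Γ x w u = Γ x u w := hsymm φ ξ
  have hvw : Γ x w v = Γ x v w := hsymm φ η
  refine ⟨fieldCurvature cov X Y Z x, ⟨⟨X, Y, Z, hX, hY, hZ, hXx, hYx, hZx⟩, ?_⟩, hRX, ?_, ?_, ?_⟩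
  · intro X' Y' Z' hX' hY' hZ' hXx' hYx' hZx'
    exact hg.dirDeriv_injective x
      ((hR X' Y' Z' hX' hY' hZ' hXx' hYx' hZx').trans hRX.symm)
  · have h1 : (dirDeriv Γ x ξ) v w - (dirDeriv Γ x ξ) w v =
        Γ x (Γ x u v) w - Γ x w (Γ x u v) + Γ x v (Γ x u w) - Γ x (Γ x u w) v :=
      hΓ.dirDeriv_sub_dirDeriv_flip hιs hcov.torsionFree x ξ η φ
    have h2 : (dirDeriv Γ x η) u w - (dirDeriv Γ x η) w u =
        Γ x (Γ x v u) w - Γ x w (Γ x v u) + Γ x u (Γ x v w) - Γ x (Γ x v w) u :=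
      hΓ.dirDeriv_sub_dirDeriv_flip hιs hcov.torsionFree x η ξ φ
    -- The terms with `Γ(u, v)` cancel between the two flips since `Γ(u, v) = Γ(v, u)`; the terms
    -- `Γ(v, Γ(u, w))` and `Γ(u, Γ(v, w))` cancel those of (1).
    rw [hRX, hvw, huw, sub_eq_iff_eq_add.1 h1, sub_eq_iff_eq_add.1 h2, huv]
    abel
  · intro hs
    -- `Γ(v, w)` need not be tangent, so symmetry on tangent pairs does not suffice here.
    have h1 : Γ x u (Γ x v w) = Γ x (Γ x v w) u := hs ξ _
    have h2 : Γ x v (Γ x u w) = Γ x (Γ x u w) v := hs η _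
    rw [hRX, hvw, huw, h1, h2]
  · intro Γ' hΓ'
    -- Applied with `S = Γ' - Γ` and `P = Π`.
    have h1 := dirDeriv_symm_of_eq_dirDeriv hιs (hΓ'.smooth.sub hΓ.smooth)
      (hg.contMDiff_metricProjection hιs) (fun y ζ => by
        ext e
        exact (congrArg (· - Γ y (dirDeriv ι y ζ) e) (hΓ'.eq y ζ e)).trans
          (add_sub_cancel_right _ _)) x ξ η
    have hd (ζ : TangentSpace 𝓘(ℝ, V) x) : dirDeriv (fun y => Γ' y - Γ y) x ζ =
        dirDeriv Γ' x ζ - dirDeriv Γ x ζ := by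
      rw [dirDeriv, mvfderiv_fun_sub (mdifferentiableAt_of_contMDiff hΓ'.smooth x)
        (mdifferentiableAt_of_contMDiff hΓ.smooth x)]
      rfl
    have h2 : (dirDeriv Γ' x ξ) v w - (dirDeriv Γ x ξ) v w =
        (dirDeriv Γ' x η) u w - (dirDeriv Γ x η) u w := by
      have h3 : (dirDeriv (fun y => Γ' y - Γ y) x ξ) v = (dirDeriv (fun y => Γ' y - Γ y) x η) u :=
        h1
      rw [hd, hd] at h3
      exact congrArg (fun T : E →L[ℝ] E => T w) h3
    rw [hRX, sub_eq_iff_eq_add.1 h2]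
    abel
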